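/- Let $\alpha\in\mathbb R$ and $\beta>0$. For a path $(X_n)_{n\ge 0}$ in $\mathbb Z$ let $\ell(n,j)=\#\{1\le m\le n:\{X_{m-1},X_m\}=\{j-1,j\}\}$ be the local time on the unoriented edge between $j-1$ and $j$, put $\Delta(n,j)=-\alpha\,\ell(n,j-1)+\ell(n,j)-\ell(n,j+1)+\alpha\,\ell(n,j+2)$ and $\Delta_n=\Delta(n,X_n)$. Let $(X_n)_{n\ge0}$ be the self-interacting nearest-neighbour random walk on $\mathbb Z$ with $X_0=0$ and, for all $n\ge 0$, $$\mathbb P\bigl(X_{n+1}=X_n\pm1\mid X_0,\dots,X_n\bigr)=\frac{e^{\pm\beta\Delta_n}}{e^{\beta\Delta_n}+e^{-\beta\Delta_n}},$$ and let $\mathcal L$ be the set of sites that the walk visits infinitely often. Let $\alpha_1=+\infty$ and $\alpha_L=\dfrac1{1+2\cos(2\pi/(L+2))}$ for $L\ge2$. Let $L\ge1$ and $\alpha\in(\alpha_{L+1},\alpha_L)$. Define $\omega\in(0,\pi)$ by $\cos\omega=\dfrac{1-\alpha}{2\alpha}$, let $\varphi=\dfrac{2\pi-(L+2)\omega}{2}$,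 and for $1\le j\le L+1$ let $$u_j=\frac{\cos\varphi-\cos(\omega j+\varphi)}{Z},\qquad Z=\sum_{i=1}^{L+1}\bigl(\cos\varphi-\cos(\omega i+\varphi)\bigr),$$ so that $u_1+\dots+u_{L+1}=1$ (in particular $Z\neq0$). Then almost surely, for every $x\in\mathbb Z$: if $\mathcal L=\{x,x+1,\dots,x+L+1\}$, then $$\lim_{n\to\infty}\frac1n\bigl(\ell(n,x+1),\dots,\ell(n,x+L+1)\bigr)=(u_1,\dots,u_{L+1}).$$ -/

import Mathlib

open MeasureTheory ProbabilityTheory Filter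
open scoped Topology

namespace StuckWalk

/-- Local time of the path `x` on the unoriented edge `j`, which joins the sites `j - 1` and `j`:
the number of steps `1 ≤ m ≤ n` with `{x (m - 1), x m} = {j - 1, j}` as unordered pairs. -/
def localTime (x : ℕ → ℤ) (n : ℕ) (j : ℤ) : ℕ :=
  ((Finset.Icc 1 n).filter (fun m => s(x (m - 1), x m) = s(j - 1, j))).card

/-- The linear combination `Δ(n, j)` of the local times of the path `x` near the site `j`. -/
noncomputable def stream (α : ℝ) (x : ℕ → ℤ) (n : ℕ) (j : ℤ) : ℝ :=
  -α * (localTime x n (j - 1) : ℝ) + (localTime x n j : ℝ)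
    - (localTime x n (j + 1) : ℝ) + α * (localTime x n (j + 2) : ℝ)

/-- The local stream `Δ_n = Δ(n, x_n)` at the current position. -/
noncomputable def currentStream (α : ℝ) (x : ℕ → ℤ) (n : ℕ) : ℝ :=
  stream α x n (x n)

/-- The σ-algebra generated by `X 0, …, X n`. -/
@[reducible] def history {Ω : Type*} (X : ℕ → Ω → ℤ) (n : ℕ) : MeasurableSpace Ω :=
  ⨆ i : Fin (n + 1), MeasurableSpace.comap (X i) inferInstance

/-- `X` is the self-interacting walk with parameters `α`, `β`, started from `0`:
given `X 0, …, X n`, it jumps by `±1` with probability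
`exp (± β Δ_n) / (exp (β Δ_n) + exp (-β Δ_n))`. -/
structure IsWalk {Ω : Type*} [MeasurableSpace Ω] (P : Measure Ω) (α β : ℝ)
    (X : ℕ → Ω → ℤ) : Prop where
  measurable : ∀ n, Measurable (X n)
  start : ∀ᵐ ω ∂P, X 0 ω = 0
  step_right : ∀ n, P⟦{ω | X (n + 1) ω = X n ω + 1} | history X n⟧ =ᵐ[P] fun ω =>
    Real.exp (β * currentStream α (fun m => X m ω) n) /
      (Real.exp (β * currentStream α (fun m => X m ω) n)
        + Real.exp (-(β * currentStream α (fun m => X m ω) n)))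
  step_left : ∀ n, P⟦{ω | X (n + 1) ω = X n ω - 1} | history X n⟧ =ᵐ[P] fun ω =>
    Real.exp (-(β * currentStream α (fun m => X m ω) n)) /
      (Real.exp (β * currentStream α (fun m => X m ω) n)
        + Real.exp (-(β * currentStream α (fun m => X m ω) n)))

/-- The set of sites that the path `x` visits infinitely often. -/
def recurrentSites (x : ℕ → ℤ) : Set ℤ :=
  {z | ∃ᶠ n in atTop, x n = z}

/-- The critical values: `α_1 = +∞` and `α_L = 1 / (1 + 2 cos (2π / (L + 2)))` for `L ≥ 2`
(the value at `L = 0` is not used). -/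
noncomputable def criticalValue (L : ℕ) : EReal :=
  if L = 1 then ⊤ else ((1 / (1 + 2 * Real.cos (2 * Real.pi / ((L : ℝ) + 2))) : ℝ) : EReal)

/-- The frequency `ω ∈ (0, π)` with `cos ω = (1 - α) / (2 α)`, for `α > 1/3`. -/
noncomputable def freq (α : ℝ) : ℝ := Real.arccos ((1 - α) / (2 * α))

/-- For `α > 1/3`, `freq α` is indeed the element of `(0, π)` with the required cosine. -/
theorem freq_spec {α : ℝ} (h : 1 / 3 < α) :
    freq α ∈ Set.Ioo 0 Real.pi ∧ Real.cos (freq α) = (1 - α) / (2 * α) := by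
  have h0 : 0 < 2 * α := by linarith
  have h1 : -1 < (1 - α) / (2 * α) := by rw [lt_div_iff₀ h0]; linarith
  have h2 : (1 - α) / (2 * α) < 1 := by rw [div_lt_one h0]; linarith
  refine ⟨⟨Real.arccos_pos.2 h2, ?_⟩, Real.cos_arccos h1.le h2.le⟩
  refine lt_of_le_of_ne (Real.arccos_le_pi _) fun h3 => ?_
  have h4 := Real.arccos_eq_pi.1 h3
  linarith

/-- The phase `φ = (2π - (L + 2) ω) / 2`. -/
noncomputable def phase (α : ℝ) (L : ℕ) : ℝ :=
  (2 * Real.pi - ((L : ℝ) + 2) * freq α) / 2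

/-- The unnormalised limit profile `cos φ - cos (ω j + φ)`. -/
noncomputable def weight (α : ℝ) (L : ℕ) (j : ℕ) : ℝ :=
  Real.cos (phase α L) - Real.cos (freq α * (j : ℝ) + phase α L)

/-- The limit profile `u_j`: the weights, normalised to have total mass `1` over
`j = 1, …, L + 1`. -/
noncomputable def profile (α : ℝ) (L : ℕ) (j : ℕ) : ℝ :=
  weight α L j / ∑ i ∈ Finset.Icc 1 (L + 1), weight α L i

end StuckWalk

namespace StuckWalk

/-! The walk is a noisy greedy descent for a quadratic energy. Give each edge a potential, the
gradient (up to a factor 2) of the form `energyForm` in the local times. The stream at a site is the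
potential of the edge on its left minus that of the edge on its right (`stream_eq_sub`), so the walk
favours the edge of lower potential. By Borel–Cantelli, from some time on it never steps against a
stream larger than `log (n + 1) / β`. A site left behind therefore keeps a stream pointing towards
the walker, up to this slack. Hence the potentials are almost unimodal around the crossed edge,
which minimises them up to `O(log n)` (`eventually_edgePotential_le`).

The profile `u` has mass one and constant potential, so it is orthogonal for the form to profiles of
mass zero. Let `v` be the deviation of the local times from linear growth along `u`. Each step adds
a unit mass at a near-minimiser and removes `u`, which raises the energy of `v` by only `O(log n)`
(`energyForm_step_le`); thus the energy is `O(n log n)`. A discrete Wirtinger inequality on the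
cycle of length `L + 2` makes the form coercive on mass zero exactly under the condition `2 α cos
(2π / (L + 2)) < 1 - α` (`le_energyForm_self`), so `v = O(√(n log n)) = o(n)`. -/

/-! ### Fourier analysis on a cycle: the discrete Wirtinger inequality. -/

theorem cos_le_cos_of_mem_Icc {a x : ℝ} (ha : 0 ≤ a) (hx : a ≤ x) (hx' : x ≤ 2 * Real.pi - a) :
    Real.cos x ≤ Real.cos a := by
  have h : Real.cos a - Real.cos x = 2 * Real.sin ((x + a) / 2) * Real.sin ((x - a) / 2) := by
    rw [Real.cos_sub_cos, show (a - x) / 2 = -((x - a) / 2) by ring, Real.sin_neg, add_comm a x]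
    ring
  have h1 : 0 ≤ Real.sin ((x + a) / 2) :=
    Real.sin_nonneg_of_nonneg_of_le_pi (by linarith) (by linarith)
  have h2 : 0 ≤ Real.sin ((x - a) / 2) :=
    Real.sin_nonneg_of_nonneg_of_le_pi (by linarith) (by linarith)
  have := mul_nonneg (mul_nonneg zero_le_two h1) h2
  linarith

/-- The discrete Fourier transform diagonalises correlations on `ℤ/N`. -/
theorem sum_stdAddChar_mul_normSq {N : ℕ} [NeZero N] (f : ZMod N → ℝ) (a : ZMod N) :
    ∑ k : ZMod N, ZMod.stdAddChar (k * a) *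
        (Complex.normSq (∑ i, (f i : ℂ) * ZMod.stdAddChar (k * i)) : ℂ)
      = N * ∑ i, (f i : ℂ) * f (i + a) := by
  have h : ∀ k : ZMod N, ZMod.stdAddChar (k * a) *
        (Complex.normSq (∑ i, (f i : ℂ) * ZMod.stdAddChar (k * i)) : ℂ)
      = ∑ i, ∑ j, (f i : ℂ) * f j * ZMod.stdAddChar (k * (i + a - j)) := by
    intro k
    rw [← Complex.mul_conj, map_sum, Finset.sum_mul_sum, Finset.mul_sum]
    refine Finset.sum_congr rfl fun i _ => ?_
    rw [Finset.mul_sum]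
    refine Finset.sum_congr rfl fun j _ => ?_
    have e : k * (i + a - j) = k * a + k * i + -(k * j) := by ring
    rw [(starRingEnd ℂ).map_mul, Complex.conj_ofReal, e, AddChar.map_add_eq_mul,
      AddChar.map_add_eq_mul, AddChar.map_neg_eq_conj]
    ring
  simp_rw [h]
  rw [Finset.sum_comm, Finset.mul_sum]
  refine Finset.sum_congr rfl fun i _ => ?_
  rw [Finset.sum_comm]
  -- Orthogonality of characters leaves only the diagonal `j = i + a`.
  have h2 : ∀ j : ZMod N, ∑ k : ZMod N, (f i : ℂ) * f j * ZMod.stdAddChar (k * (i + a - j))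
      = if j = i + a then (N : ℂ) * (f i * f j) else 0 := by
    intro j
    rw [← Finset.mul_sum, AddChar.sum_mulShift _ (ZMod.isPrimitive_stdAddChar N), ZMod.card]
    by_cases hj : j = i + a
    · simp [hj]; ring
    · rw [if_neg (by rwa [sub_eq_zero, eq_comm]), if_neg hj]; simp
  simp_rw [h2]
  simp

/-- Discrete Wirtinger inequality on the cycle `ℤ/N`. -/
theorem sum_mul_shift_le_zmod {N : ℕ} [NeZero N] (f : ZMod N → ℝ) (hf : ∑ i, f i = 0) :
    ∑ i, f i * f (i + 1) ≤ Real.cos (2 * Real.pi / N) * ∑ i, f i ^ 2 := by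
  set p : ZMod N → ℝ := fun k => Complex.normSq (∑ i, (f i : ℂ) * ZMod.stdAddChar (k * i)) with hp
  have hN : (0 : ℝ) < N := by exact_mod_cast Nat.pos_of_ne_zero (NeZero.ne N)
  have h1 : ∑ k : ZMod N, (ZMod.stdAddChar k : ℂ).re * p k = N * ∑ i, f i * f (i + 1) := by
    have := congrArg Complex.re (sum_stdAddChar_mul_normSq f 1)
    simp only [mul_one] at this
    rw [Complex.re_sum] at this
    simp only [Complex.re_mul_ofReal] at this
    rw [this]
    norm_cast
  have h0 : ∑ k : ZMod N, p k = N * ∑ i, f i ^ 2 := by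
    have := congrArg Complex.re (sum_stdAddChar_mul_normSq f 0)
    simp only [mul_zero, AddChar.map_zero_eq_one, one_mul, add_zero] at this
    rw [Complex.re_sum] at this
    simp only [Complex.ofReal_re] at this
    rw [this]
    simp only [pow_two]
    norm_cast
  -- Mass zero kills the constant mode, the only one whose eigenvalue would exceed `cos (2π / N)`.
  have hp0 : p 0 = 0 := by
    simp only [hp, zero_mul, AddChar.map_zero_eq_one, mul_one]
    rw [← Complex.ofReal_sum, hf]; simp
  have hk : ∀ k : ZMod N,
      (ZMod.stdAddChar k : ℂ).re * p k ≤ Real.cos (2 * Real.pi / N) * p k := by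
    intro k
    by_cases hk : k = 0
    · simp [hk, hp0]
    refine mul_le_mul_of_nonneg_right ?_ (Complex.normSq_nonneg _)
    have e : (ZMod.stdAddChar k : ℂ).re = Real.cos (2 * Real.pi * k.val / N) := by
      have : k = ((k.val : ℤ) : ZMod N) := by simp
      conv_lhs => rw [this]
      rw [ZMod.stdAddChar_coe]
      have : (2 * Real.pi * Complex.I * ((k.val : ℤ) : ℂ) / N : ℂ)
          = ((2 * Real.pi * k.val / N : ℝ) : ℂ) * Complex.I := by push_cast; ring
      rw [this, Complex.exp_ofReal_mul_I_re]
    rw [e]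
    -- A nonzero mode has `1 ≤ k ≤ N - 1`, so its angle lies in `[2π / N, 2π - 2π / N]`.
    have h1 : (1 : ℝ) ≤ k.val := by
      exact_mod_cast Nat.one_le_iff_ne_zero.2 (by simpa using hk)
    have h2 : (k.val : ℝ) + 1 ≤ N := by exact_mod_cast ZMod.val_lt k
    have hpi := Real.pi_pos
    apply cos_le_cos_of_mem_Icc (by positivity)
    · exact div_le_div_of_nonneg_right (by nlinarith) hN.le
    · rw [le_sub_iff_add_le, ← add_div, div_le_iff₀ hN]; nlinarith
  have := Finset.sum_le_sum fun k (_ : k ∈ Finset.univ) => hk k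
  rw [h1, ← Finset.mul_sum, h0] at this
  refine le_of_mul_le_mul_left ?_ hN
  linarith

theorem sum_mul_shift_le {m : ℕ} (v : ℕ → ℝ) (h0 : v m = v 0)
    (hv : ∑ i ∈ Finset.range m, v i = 0) :
    ∑ i ∈ Finset.range m, v i * v (i + 1)
      ≤ Real.cos (2 * Real.pi / m) * ∑ i ∈ Finset.range m, v i ^ 2 := by
  obtain _ | n := m
  · simp
  have key := sum_mul_shift_le_zmod (N := n + 1) (fun z => v z.val)
  have e (g : ℕ → ℝ) : ∑ z : ZMod (n + 1), g z.val = ∑ i ∈ Finset.range (n + 1), g i :=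
    Fin.sum_univ_eq_sum_range g (n + 1)
  have hs : ∀ z : ZMod (n + 1), v (z + 1).val = v (z.val + 1) := by
    intro z
    have h1 : z + 1 = ((z.val + 1 : ℕ) : ZMod (n + 1)) := by push_cast; simp
    rw [h1, ZMod.val_natCast]
    rcases (Nat.succ_le_of_lt (ZMod.val_lt z)).lt_or_eq with h | h
    · rw [Nat.mod_eq_of_lt h]
    · rw [show z.val + 1 = n + 1 from h, Nat.mod_self, h0]
  simp only [hs] at key
  rw [e v, e (fun i => v i * v (i + 1)), e (fun i => v i ^ 2)] at key
  exact key hv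

/-! ### The quadratic energy of a local time profile. -/

/-- The potential of the edge `i + 1` for the local time profile `g`. -/
noncomputable def edgePotential (α : ℝ) (g : ℕ → ℝ) (i : ℕ) : ℝ :=
  (1 - α) * g (i + 1) - α * g i - α * g (i + 2)

/-- The bilinear form whose gradient is the edge potential, on profiles over the edges `1, …, k`. -/
noncomputable def energyForm (α : ℝ) (k : ℕ) (f g : ℕ → ℝ) : ℝ :=
  ∑ i ∈ Finset.range k, f (i + 1) * edgePotential α g i

theorem edgePotential_add (α : ℝ) (f g : ℕ → ℝ) (i : ℕ) :
    edgePotential α (f + g) i = edgePotential α f i + edgePotential α g i := by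
  simp only [edgePotential, Pi.add_apply]; ring

theorem edgePotential_sub (α : ℝ) (f g : ℕ → ℝ) (i : ℕ) :
    edgePotential α (f - g) i = edgePotential α f i - edgePotential α g i := by
  simp only [edgePotential, Pi.sub_apply]; ring

theorem edgePotential_smul (α c : ℝ) (f : ℕ → ℝ) (i : ℕ) :
    edgePotential α (c • f) i = c * edgePotential α f i := by
  simp only [edgePotential, Pi.smul_apply, smul_eq_mul]; ring

theorem energyForm_add_left (α : ℝ) (k : ℕ) (f g h : ℕ → ℝ) :
    energyForm α k (f + g) h = energyForm α k f h + energyForm α k g h := by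
  simp only [energyForm, ← Finset.sum_add_distrib, Pi.add_apply, add_mul]

theorem energyForm_add_right (α : ℝ) (k : ℕ) (f g h : ℕ → ℝ) :
    energyForm α k f (g + h) = energyForm α k f g + energyForm α k f h := by
  simp only [energyForm, edgePotential_add, ← Finset.sum_add_distrib, mul_add]

theorem energyForm_sub_left (α : ℝ) (k : ℕ) (f g h : ℕ → ℝ) :
    energyForm α k (f - g) h = energyForm α k f h - energyForm α k g h := by
  simp only [energyForm, ← Finset.sum_sub_distrib, Pi.sub_apply, sub_mul]

theorem energyForm_sub_right (α : ℝ) (k : ℕ) (f g h : ℕ → ℝ) :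
    energyForm α k f (g - h) = energyForm α k f g - energyForm α k f h := by
  simp only [energyForm, edgePotential_sub, ← Finset.sum_sub_distrib, mul_sub]

theorem energyForm_single (α : ℝ) {k c : ℕ} (hc : c < k) (g : ℕ → ℝ) :
    energyForm α k (Pi.single (c + 1) 1) g = edgePotential α g c := by
  rw [energyForm, Finset.sum_eq_single_of_mem c (Finset.mem_range.2 hc)]
  · simp
  · intro i _ hi
    rw [Pi.single_eq_of_ne (by omega), zero_mul]

theorem sum_range_succ_mul_eq {k : ℕ} {f g : ℕ → ℝ} (hf : f (k + 1) = 0) (hg : g 0 = 0) :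
    ∑ i ∈ Finset.range k, f (i + 1) * g i = ∑ i ∈ Finset.range k, g (i + 1) * f (i + 2) := by
  have h1 := Finset.sum_range_succ (fun i => f (i + 1) * g i) k
  have h2 := Finset.sum_range_succ' (fun i => f (i + 1) * g i) k
  simp only [hf, hg, zero_mul, mul_zero, add_zero] at h1 h2
  rw [← h1, h2]
  exact Finset.sum_congr rfl fun i _ => mul_comm _ _

theorem energyForm_eq (α : ℝ) (k : ℕ) (f g : ℕ → ℝ) :
    energyForm α k f g = (1 - α) * ∑ i ∈ Finset.range k, f (i + 1) * g (i + 1)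
      - α * (∑ i ∈ Finset.range k, f (i + 1) * g i)
      - α * ∑ i ∈ Finset.range k, f (i + 1) * g (i + 2) := by
  simp only [energyForm, edgePotential, Finset.mul_sum, ← Finset.sum_sub_distrib]
  exact Finset.sum_congr rfl fun i _ => by ring

/-- The two neighbour sums are exchanged by a shift of index; the boundary terms vanish because both
profiles are zero at `0` and `k + 1`. -/
theorem energyForm_comm (α : ℝ) {k : ℕ} {f g : ℕ → ℝ} (hf0 : f 0 = 0) (hf : f (k + 1) = 0)
    (hg0 : g 0 = 0) (hg : g (k + 1) = 0) :
    energyForm α k f g = energyForm α k g f := by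
  rw [energyForm_eq, energyForm_eq, sum_range_succ_mul_eq hf hg0, sum_range_succ_mul_eq hg hf0]
  simp only [mul_comm (f (_ + 1)) (g (_ + 1))]
  ring

/-- On profiles of total mass zero the energy form is bounded below. -/
theorem le_energyForm_self {α : ℝ} (hα : 0 ≤ α) {k : ℕ} {v : ℕ → ℝ} (h0 : v 0 = 0)
    (h1 : v (k + 1) = 0) (hv : ∑ i ∈ Finset.range k, v (i + 1) = 0) :
    (1 - α - 2 * α * Real.cos (2 * Real.pi / (k + 1 : ℕ))) * ∑ i ∈ Finset.range k, v (i + 1) ^ 2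
      ≤ energyForm α k v v := by
  -- The zeros at `0` and `k + 1` are glued into one point, which closes the `k` edges to a cycle of
  -- length `k + 1`.
  have h := sum_mul_shift_le (m := k + 1) v (h1.trans h0.symm)
    (by rw [Finset.sum_range_succ', hv, h0, add_zero])
  rw [Finset.sum_range_succ, h1, mul_zero, add_zero, Finset.sum_range_succ' (fun i => v i ^ 2),
    h0, zero_pow two_ne_zero, add_zero] at h
  rw [energyForm_eq, sum_range_succ_mul_eq h1 h0]
  have e : ∑ i ∈ Finset.range k, v (i + 1) * v (i + 2) = ∑ i ∈ Finset.range k, v i * v (i + 1) := by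
    rw [← sum_range_succ_mul_eq h1 h0]
    exact Finset.sum_congr rfl fun i _ => mul_comm _ _
  rw [e]
  simp only [← pow_two]
  have := mul_le_mul_of_nonneg_left h (mul_nonneg zero_le_two hα)
  linarith

/-- Adding mass one at an edge whose potential is minimal up to `σ`, and removing a critical
probability profile `u`, increases the energy by at most `2 σ` plus a constant. -/
theorem energyForm_step_le {α lam σ : ℝ} {k c : ℕ} {u v : ℕ → ℝ} (hu0 : u 0 = 0)
    (hu1 : u (k + 1) = 0) (hu : ∀ i < k, 0 ≤ u (i + 1)) (hus : ∑ i ∈ Finset.range k, u (i + 1) = 1)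
    (hlam : ∀ i < k, edgePotential α u i = lam) (hv0 : v 0 = 0) (hv1 : v (k + 1) = 0)
    (hv : ∑ i ∈ Finset.range k, v (i + 1) = 0) (hc : c < k)
    (hmin : ∀ i < k, edgePotential α v c ≤ edgePotential α v i + σ) :
    energyForm α k (v + (Pi.single (c + 1) 1 - u)) (v + (Pi.single (c + 1) 1 - u))
      ≤ energyForm α k v v + (2 * σ + (1 - α - lam)) := by
  have hfu : ∀ f : ℕ → ℝ, energyForm α k f u = lam * ∑ i ∈ Finset.range k, f (i + 1) := by
    intro f
    rw [energyForm, Finset.mul_sum]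
    refine Finset.sum_congr rfl fun i hi => ?_
    rw [hlam i (Finset.mem_range.1 hi), mul_comm]
  have hvu : energyForm α k v u = 0 := by rw [hfu, hv, mul_zero]
  have huv : energyForm α k u v = 0 := by rw [energyForm_comm α hu0 hu1 hv0 hv1, hvu]
  have huu : energyForm α k u u = lam := by rw [hfu, hus, mul_one]
  have hs0 : (Pi.single (c + 1) 1 : ℕ → ℝ) 0 = 0 := by simp
  have hs1 : (Pi.single (c + 1) 1 : ℕ → ℝ) (k + 1) = 0 := Pi.single_eq_of_ne (by omega) _
  have hss : edgePotential α (Pi.single (c + 1) 1) c = 1 - α := by simp [edgePotential]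
  -- Average `hmin` against the probability weights `u`: the `u`-mean of the potential of `v` is
  -- `energyForm α k u v = 0`.
  have hc' : edgePotential α v c ≤ σ := by
    have : ∑ i ∈ Finset.range k, u (i + 1) * edgePotential α v c
        ≤ ∑ i ∈ Finset.range k, u (i + 1) * (edgePotential α v i + σ) :=
      Finset.sum_le_sum fun i hi => mul_le_mul_of_nonneg_left (hmin i (Finset.mem_range.1 hi))
        (hu i (Finset.mem_range.1 hi))
    simp only [mul_add, Finset.sum_add_distrib, ← Finset.sum_mul, hus, one_mul] at this
    rw [← energyForm, huv] at this
    linarith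
  simp only [energyForm_add_left, energyForm_add_right, energyForm_sub_left, energyForm_sub_right,
    energyForm_comm α hv0 hv1 hs0 hs1, energyForm_comm α hu0 hu1 hs0 hs1,
    energyForm_single α hc, hss, hvu, huv, huu, hlam c hc]
  linarith

/-! ### The parameter range and the critical profile. -/

theorem parameter_bounds {L : ℕ} (hL : 1 ≤ L) {α : ℝ}
    (hα_lower : criticalValue (L + 1) < (α : EReal)) (hα_upper : (α : EReal) < criticalValue L) :
    1 / 3 < α ∧ Real.cos (2 * Real.pi / (L + 2)) < (1 - α) / (2 * α) := by
  have hpi := Real.pi_pos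
  have hL' : (1 : ℝ) ≤ L := by exact_mod_cast hL
  have h1 : 1 / 3 < α := by
    rw [criticalValue, if_neg (by omega), EReal.coe_lt_coe_iff] at hα_lower
    refine lt_of_le_of_lt ?_ hα_lower
    -- Since `L + 3 ≥ 4` the angle is at most `π / 2`, so the denominator of the critical value lies
    -- in `[1, 3]`.
    have h0 : 0 ≤ Real.cos (2 * Real.pi / (((L + 1 : ℕ) : ℝ) + 2)) := by
      push_cast
      apply Real.cos_nonneg_of_neg_pi_div_two_le_of_le
      · have : 0 ≤ 2 * Real.pi / ((L : ℝ) + 1 + 2) := by positivity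
        linarith
      · rw [div_le_iff₀ (by positivity)]; nlinarith
    have h1 := Real.cos_le_one (2 * Real.pi / (((L + 1 : ℕ) : ℝ) + 2))
    apply one_div_le_one_div_of_le <;> linarith
  refine ⟨h1, ?_⟩
  have h2 : 0 < 2 * α := by linarith
  rw [lt_div_iff₀ h2]
  rcases hL.eq_or_lt with rfl | h
  -- For `L = 1` the upper critical value is infinite, and the claim reduces to `-α < 1 - α`.
  · have : Real.cos (2 * Real.pi / (((1 : ℕ) : ℝ) + 2)) = -(1 / 2) := by
      rw [show 2 * Real.pi / (((1 : ℕ) : ℝ) + 2) = Real.pi - Real.pi / 3 by push_cast; ring,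
        Real.cos_pi_sub, Real.cos_pi_div_three]
    rw [this]; linarith
  · rw [criticalValue, if_neg (by omega), EReal.coe_lt_coe_iff] at hα_upper
    have h0 : 0 ≤ Real.cos (2 * Real.pi / ((L : ℝ) + 2)) := by
      have hL2 : (2 : ℝ) ≤ L := by exact_mod_cast h
      apply Real.cos_nonneg_of_neg_pi_div_two_le_of_le
      · have : 0 ≤ 2 * Real.pi / ((L : ℝ) + 2) := by positivity
        linarith
      · rw [div_le_iff₀ (by positivity)]; nlinarith
    rw [lt_div_iff₀ (by linarith)] at hα_upper
    linarith

/-- The phase makes the weights symmetric under `j ↦ L + 2 - j`. The product form displays the zeros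
at `0` and `L + 2`, and positivity in between once `(L + 2) ω < 2π`. -/
theorem weight_eq (α : ℝ) (L j : ℕ) :
    weight α L j
      = 2 * Real.sin (freq α * (L + 2 - j) / 2) * Real.sin (freq α * j / 2) := by
  have h : Real.sin (freq α * (L + 2 - j) / 2) = Real.sin (freq α * j / 2 + phase α L) := by
    rw [← Real.sin_pi_sub]; congr 1; unfold phase; ring
  rw [weight, Real.cos_sub_cos, h, show (phase α L - (freq α * j + phase α L)) / 2
    = -(freq α * j / 2) by ring, Real.sin_neg,
    show (phase α L + (freq α * j + phase α L)) / 2 = freq α * j / 2 + phase α L by ring]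
  ring

theorem weight_zero (α : ℝ) (L : ℕ) : weight α L 0 = 0 := by simp [weight]

theorem weight_add_two (α : ℝ) (L : ℕ) : weight α L (L + 2) = 0 := by
  rw [weight_eq]; push_cast; simp

theorem freq_mul_lt {L : ℕ} {α : ℝ} (hα : 1 / 3 < α)
    (h : Real.cos (2 * Real.pi / (L + 2)) < (1 - α) / (2 * α)) : freq α * (L + 2) < 2 * Real.pi := by
  have hpi := Real.pi_pos
  obtain ⟨⟨h1, h2⟩, h3⟩ := freq_spec hα
  rw [← lt_div_iff₀ (by positivity)]
  rw [← h3] at h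
  by_contra! hc
  exact absurd (Real.cos_le_cos_of_nonneg_of_le_pi (by positivity) h2.le hc) (not_le.2 h)

theorem weight_pos {L : ℕ} {α : ℝ} (hα : 1 / 3 < α) (h : freq α * (L + 2) < 2 * Real.pi) {j : ℕ}
    (hj : 0 < j) (hj' : j < L + 2) : 0 < weight α L j := by
  have h1 := (freq_spec hα).1.1
  have hj1 : (0 : ℝ) < j := by exact_mod_cast hj
  have hj2 : (j : ℝ) < L + 2 := by exact_mod_cast hj'
  rw [weight_eq]
  have a1 : 0 < Real.sin (freq α * (L + 2 - j) / 2) :=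
    Real.sin_pos_of_pos_of_lt_pi (by have := mul_pos h1 (sub_pos.2 hj2); linarith) (by nlinarith)
  have a2 : 0 < Real.sin (freq α * j / 2) :=
    Real.sin_pos_of_pos_of_lt_pi (by positivity) (by nlinarith)
  positivity

/-- The relation `2 α cos ω = 1 - α` says that the oscillating part lies in the kernel of the
potential operator; only the constant `cos φ` contributes. -/
theorem edgePotential_weight {α : ℝ} (hα : 1 / 3 < α) (L i : ℕ) :
    edgePotential α (weight α L) i = (1 - 3 * α) * Real.cos (phase α L) := by
  have h := (freq_spec hα).2
  have h' : 2 * α * Real.cos (freq α) = 1 - α := by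
    rw [h]; field_simp
  obtain ⟨y, hy⟩ : ∃ y, y = freq α * ((i : ℝ) + 1) + phase α L := ⟨_, rfl⟩
  have e0 : freq α * (i : ℝ) + phase α L = y - freq α := by rw [hy]; ring
  have e2 : freq α * ((i : ℝ) + 2) + phase α L = y + freq α := by rw [hy]; ring
  simp only [edgePotential, weight]
  push_cast
  rw [e0, e2, ← hy, Real.cos_sub, Real.cos_add]
  linear_combination Real.cos y * h'

theorem sum_weight (α : ℝ) (L : ℕ) :
    ∑ j ∈ Finset.Icc 1 (L + 1), weight α L j = ∑ i ∈ Finset.range (L + 1), weight α L (i + 1) := by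
  rw [Finset.range_eq_Ico, Finset.sum_Ico_add' (fun j => weight α L j) 0 (L + 1) 1]
  rfl

theorem sum_weight_pos {L : ℕ} {α : ℝ} (hα : 1 / 3 < α) (h : freq α * (L + 2) < 2 * Real.pi) :
    0 < ∑ j ∈ Finset.Icc 1 (L + 1), weight α L j :=
  Finset.sum_pos (fun j hj => by
    rw [Finset.mem_Icc] at hj
    exact weight_pos hα h (by omega) (by omega)) ⟨1, by simp⟩

theorem sum_profile {L : ℕ} {α : ℝ} (hα : 1 / 3 < α) (h : freq α * (L + 2) < 2 * Real.pi) :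
    ∑ j ∈ Finset.Icc 1 (L + 1), profile α L j = 1 := by
  simp only [profile, ← Finset.sum_div]
  exact div_self (sum_weight_pos hα h).ne'

theorem sum_range_profile {L : ℕ} {α : ℝ} (hα : 1 / 3 < α)
    (h : freq α * (L + 2) < 2 * Real.pi) :
    ∑ i ∈ Finset.range (L + 1), profile α L (i + 1) = 1 := by
  simp only [profile, ← Finset.sum_div]
  rw [← sum_weight]
  exact div_self (sum_weight_pos hα h).ne'

theorem edgePotential_profile {α : ℝ} (hα : 1 / 3 < α) (L i : ℕ) :
    edgePotential α (profile α L) i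
      = (1 - 3 * α) * Real.cos (phase α L) / ∑ j ∈ Finset.Icc 1 (L + 1), weight α L j := by
  rw [← edgePotential_weight hα L i]
  simp only [edgePotential, profile]
  ring

/-! ### Probability: nearest-neighbour steps and Borel–Cantelli. -/

theorem localTime_congr {x y : ℕ → ℤ} {n : ℕ} (h : ∀ m ≤ n, x m = y m) (j : ℤ) :
    localTime x n j = localTime y n j := by
  unfold localTime
  congr 1
  refine Finset.filter_congr fun m hm => ?_
  rw [Finset.mem_Icc] at hm
  rw [h m hm.2, h (m - 1) (by omega)]

theorem currentStream_congr {x y : ℕ → ℤ} {n : ℕ} (h : ∀ m ≤ n, x m = y m) (α : ℝ) :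
    currentStream α x n = currentStream α y n := by
  simp only [currentStream, stream, localTime_congr h, h n le_rfl]

/-- The stream at time `n` factors through `n + 1` integer coordinates, a countable space on which
every function is measurable. -/
theorem measurable_currentStream (α : ℝ) {Ω : Type*} (X : ℕ → Ω → ℤ) (n : ℕ) :
    Measurable[history X n] fun ω => currentStream α (fun m => X m ω) n := by
  have h1 : Measurable[history X n] fun ω => fun i : Fin (n + 1) => X i ω := by
    refine @measurable_pi_lambda _ _ _ (history X n) _ _ fun i => ?_
    exact (comap_measurable (X i)).mono
      (le_iSup (fun i : Fin (n + 1) => MeasurableSpace.comap (X i) inferInstance) i) le_rfl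
  have h2 : Measurable fun y : Fin (n + 1) → ℤ =>
      currentStream α (fun m => if h : m < n + 1 then y ⟨m, h⟩ else 0) n :=
    measurable_of_countable _
  have h3 := h2.comp h1
  convert h3 using 2 with ω
  refine currentStream_congr (fun m hm => ?_) α
  simp [Nat.lt_succ_of_le hm]

section Probability

variable {Ω : Type*} [mΩ : MeasurableSpace Ω]

theorem history_le {X : ℕ → Ω → ℤ} (hX : ∀ n, Measurable (X n)) (n : ℕ) : history X n ≤ mΩ :=
  iSup_le fun i => (hX i).comap_le

theorem measure_inter_le_of_condProb_le {P : Measure Ω} [IsProbabilityMeasure P]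
    {m : MeasurableSpace Ω} (hm : m ≤ mΩ) {A S : Set Ω} (hA : MeasurableSet[mΩ] A)
    (hS : MeasurableSet[m] S) {p : Ω → ℝ} (hp : P⟦A | m⟧ =ᵐ[P] p) {c : ℝ} (hc : 0 ≤ c)
    (hpc : ∀ ω ∈ S, p ω ≤ c) : P (A ∩ S) ≤ ENNReal.ofReal c := by
  have hint : Integrable (A.indicator fun _ => (1 : ℝ)) P :=
    (integrable_const _).indicator hA
  have h1 := setIntegral_condExp hm hint hS
  rw [setIntegral_indicator hA, setIntegral_const, smul_eq_mul, mul_one, Set.inter_comm] at h1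
  have h2 : ∫ ω in S, (P⟦A | m⟧) ω ∂P ≤ ∫ _ in S, c ∂P := by
    refine setIntegral_mono_on_ae integrable_condExp.integrableOn (integrable_const _).integrableOn
      (hm _ hS) ?_
    filter_upwards [hp] with ω hω hωS
    rw [hω]
    exact hpc ω hωS
  rw [setIntegral_const, smul_eq_mul, h1] at h2
  rw [← ENNReal.ofReal_toReal (measure_ne_top P (A ∩ S))]
  apply ENNReal.ofReal_le_ofReal
  refine h2.trans ?_
  exact mul_le_of_le_one_left hc measureReal_le_one

/-- The jump probability is at most `exp (2 β D)`; the threshold `log (n + 1) / β` turns this into a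
summable bound. -/
theorem exp_div_le_of_lt {β D : ℝ} {n : ℕ} (hβ : 0 < β) (h : D < -(Real.log (n + 1) / β)) :
    Real.exp (β * D) / (Real.exp (β * D) + Real.exp (-(β * D))) ≤ 1 / ((n : ℝ) + 1) ^ 2 := by
  have hn : (0 : ℝ) < (n : ℝ) + 1 := by positivity
  have h1 : β * D ≤ -Real.log (n + 1) := by
    have := mul_lt_mul_of_pos_left h hβ
    rw [mul_neg, mul_div_cancel₀ _ hβ.ne'] at this
    exact this.le
  have h2 : Real.exp (β * D) ≤ 1 / ((n : ℝ) + 1) := by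
    have := Real.exp_le_exp.2 h1
    rwa [Real.exp_neg, Real.exp_log hn, ← one_div] at this
  have hpos := Real.exp_pos (β * D)
  calc Real.exp (β * D) / (Real.exp (β * D) + Real.exp (-(β * D)))
      ≤ Real.exp (β * D) / Real.exp (-(β * D)) :=
        div_le_div_of_nonneg_left hpos.le (Real.exp_pos _) (by linarith)
    _ = Real.exp (β * D) ^ 2 := by
        rw [Real.exp_neg, div_inv_eq_mul, sq]
    _ ≤ (1 / ((n : ℝ) + 1)) ^ 2 := by gcongr
    _ = 1 / ((n : ℝ) + 1) ^ 2 := by rw [one_div_pow]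

theorem tsum_ofReal_one_div_sq_ne_top :
    ∑' n : ℕ, ENNReal.ofReal (1 / ((n : ℝ) + 1) ^ 2) ≠ ⊤ := by
  have h : Summable fun n : ℕ => 1 / ((n : ℝ) + 1) ^ 2 := by
    have := (summable_nat_add_iff 1).2 (Real.summable_one_div_nat_pow.2 one_lt_two)
    simpa using this
  exact h.tsum_ofReal_ne_top

variable {P : Measure Ω} [IsProbabilityMeasure P] {α β : ℝ} {X : ℕ → Ω → ℤ}

/-- The two prescribed conditional probabilities add up to one, and the two events are disjoint. -/
theorem IsWalk.ae_step (hX : IsWalk P α β X) :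
    ∀ᵐ ω ∂P, ∀ n, X (n + 1) ω = X n ω + 1 ∨ X (n + 1) ω = X n ω - 1 := by
  rw [ae_all_iff]
  intro n
  have hR : MeasurableSet {ω | X (n + 1) ω = X n ω + 1} :=
    measurableSet_eq_fun (hX.measurable _) ((hX.measurable n).add_const 1)
  have hL : MeasurableSet {ω | X (n + 1) ω = X n ω - 1} :=
    measurableSet_eq_fun (hX.measurable _) ((hX.measurable n).sub_const 1)
  have hm := history_le hX.measurable n
  have real_eq (A : Set Ω) (hA : MeasurableSet A) :
      ∫ ω, (P⟦A | history X n⟧) ω ∂P = P.real A := by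
    rw [integral_condExp hm, integral_indicator hA, setIntegral_const, smul_eq_mul, mul_one]
  have h1 : P.real {ω | X (n + 1) ω = X n ω + 1} + P.real {ω | X (n + 1) ω = X n ω - 1} = 1 := by
    rw [← real_eq _ hR, ← real_eq _ hL, ← integral_add integrable_condExp integrable_condExp]
    have : (fun ω => (P⟦{ω | X (n + 1) ω = X n ω + 1} | history X n⟧) ω
        + (P⟦{ω | X (n + 1) ω = X n ω - 1} | history X n⟧) ω) =ᵐ[P] fun _ => (1 : ℝ) := by
      filter_upwards [hX.step_right n, hX.step_left n] with ω h1 h2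
      rw [h1, h2, ← add_div]
      exact div_self (by positivity)
    rw [integral_congr_ae this]
    simp
  have hd : Disjoint {ω | X (n + 1) ω = X n ω + 1} {ω | X (n + 1) ω = X n ω - 1} := by
    rw [Set.disjoint_left]
    intro ω h1 h2
    simp only [Set.mem_ofPred_eq] at h1 h2
    omega
  rw [← measureReal_union hd hL] at h1
  have h2 : P ({ω | X (n + 1) ω = X n ω + 1} ∪ {ω | X (n + 1) ω = X n ω - 1}) = 1 := by
    rw [← ENNReal.ofReal_toReal (measure_ne_top P _), ← measureReal_def, h1, ENNReal.ofReal_one]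
  exact (prob_compl_eq_zero_iff (hR.union hL)).2 h2

/-- Almost surely, from some time on the walk makes no step against a stream that exceeds a
multiple of the logarithm of the time. -/
theorem IsWalk.ae_eventually_stream (hβ : 0 < β) (hX : IsWalk P α β X) :
    ∀ᵐ ω ∂P, ∀ᶠ n : ℕ in atTop,
      (X (n + 1) ω = X n ω + 1 →
        -(Real.log (n + 1) / β) ≤ currentStream α (fun m => X m ω) n) ∧
      (X (n + 1) ω = X n ω - 1 →
        currentStream α (fun m => X m ω) n ≤ Real.log (n + 1) / β) := by
  have hmeas := measurable_currentStream α X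
  have hR : ∀ n : ℕ, P ({ω | X (n + 1) ω = X n ω + 1} ∩
      {ω | currentStream α (fun m => X m ω) n < -(Real.log (n + 1) / β)})
      ≤ ENNReal.ofReal (1 / ((n : ℝ) + 1) ^ 2) := fun n =>
    measure_inter_le_of_condProb_le (history_le hX.measurable n)
      (measurableSet_eq_fun (hX.measurable _) ((hX.measurable n).add_const 1))
      (hmeas n measurableSet_Iio) (hX.step_right n) (by positivity)
      fun ω hω => exp_div_le_of_lt hβ hω
  have hL : ∀ n : ℕ, P ({ω | X (n + 1) ω = X n ω - 1} ∩
      {ω | Real.log (n + 1) / β < currentStream α (fun m => X m ω) n})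
      ≤ ENNReal.ofReal (1 / ((n : ℝ) + 1) ^ 2) := fun n =>
    measure_inter_le_of_condProb_le (history_le hX.measurable n)
      (measurableSet_eq_fun (hX.measurable _) ((hX.measurable n).sub_const 1))
      (hmeas n measurableSet_Ioi) (hX.step_left n) (by positivity)
      fun ω hω => by
        have := exp_div_le_of_lt (D := -currentStream α (fun m => X m ω) n) hβ (neg_lt_neg hω)
        rwa [mul_neg, neg_neg, add_comm] at this
  filter_upwards [ae_eventually_notMem (ne_top_of_le_ne_top tsum_ofReal_one_div_sq_ne_top
      (ENNReal.tsum_le_tsum hR)), ae_eventually_notMem (ne_top_of_le_ne_top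
      tsum_ofReal_one_div_sq_ne_top (ENNReal.tsum_le_tsum hL))] with ω h1 h2
  filter_upwards [h1, h2] with n h1 h2
  exact ⟨fun h => not_lt.1 fun h' => h1 ⟨h, h'⟩, fun h => not_lt.1 fun h' => h2 ⟨h, h'⟩⟩

end Probability

/-! ### Deterministic paths: crossed edges nearly minimise the potential. -/

theorem localTime_succ {x : ℕ → ℤ} {n : ℕ} (hx : x (n + 1) = x n + 1 ∨ x (n + 1) = x n - 1)
    (j : ℤ) :
    (localTime x (n + 1) j : ℝ)
      = localTime x n j + if j = max (x n) (x (n + 1)) then 1 else 0 := by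
  have h : s(x n, x (n + 1)) = s(j - 1, j) ↔ j = max (x n) (x (n + 1)) := by
    rw [Sym2.eq_iff]; omega
  simp only [localTime, Finset.card_filter]
  rw [Finset.sum_Icc_succ_top (by omega)]
  simp [h]

theorem stream_succ (α : ℝ) {x : ℕ → ℤ} {n : ℕ}
    (hx : x (n + 1) = x n + 1 ∨ x (n + 1) = x n - 1) (j : ℤ) :
    stream α x (n + 1) j = stream α x n j
      + (-α * (if j - 1 = max (x n) (x (n + 1)) then 1 else 0)
        + (if j = max (x n) (x (n + 1)) then 1 else 0)
        - (if j + 1 = max (x n) (x (n + 1)) then 1 else 0)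
        + α * (if j + 2 = max (x n) (x (n + 1)) then 1 else 0)) := by
  simp only [stream, localTime_succ hx]; ring

/-- A path that never steps against a stream larger than `s` keeps, after visiting `j`, the stream
at `j` directed towards its current position, up to `s + 1`. -/
theorem stream_bounds {α : ℝ} (hα : 0 ≤ α) {x : ℕ → ℤ} {s : ℕ → ℝ} (hs : Monotone s) {N : ℕ}
    {j : ℤ} (hx : ∀ n, x (n + 1) = x n + 1 ∨ x (n + 1) = x n - 1)
    (hslack : ∀ n ≥ N, (x (n + 1) = x n + 1 → -s n ≤ currentStream α x n) ∧
      (x (n + 1) = x n - 1 → currentStream α x n ≤ s n)) (hN : x N = j) :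
    ∀ n ≥ N, (x n < j → stream α x n j ≤ s n + 1) ∧ (j < x n → -(s n + 1) ≤ stream α x n j) := by
  intro n hn
  induction n, hn using Nat.le_induction with
  | base => constructor <;> intro h <;> omega
  | succ n hn ih =>
    have hmono := hs n.le_succ
    rw [stream_succ α (hx n) j]
    constructor
    -- While the path stays to the left of `j`, only crossings of the edge `j - 1` matter, and they
    -- lower the stream as `α ≥ 0`. The extra `1` is the crossing of edge `j` on leaving `j`, when
    -- the slack bound applies.
    · intro h
      rw [if_neg (show ¬ j + 1 = max (x n) (x (n + 1)) by have := hx n; omega),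
        if_neg (show ¬ j + 2 = max (x n) (x (n + 1)) by have := hx n; omega)]
      rcases lt_or_ge (x n) j with h1 | h1
      · have := ih.1 h1
        rw [if_neg (show ¬ j = max (x n) (x (n + 1)) by omega)]
        split_ifs <;> linarith
      · have h2 : x n = j := by have := hx n; omega
        have := (hslack n hn).2 (by have := hx n; omega)
        rw [currentStream, h2] at this
        split_ifs <;> linarith
    · intro h
      rw [if_neg (show ¬ j - 1 = max (x n) (x (n + 1)) by have := hx n; omega),
        if_neg (show ¬ j = max (x n) (x (n + 1)) by have := hx n; omega)]
      rcases lt_or_ge j (x n) with h1 | h1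
      · have := ih.2 h1
        rw [if_neg (show ¬ j + 1 = max (x n) (x (n + 1)) by have := hx n; omega)]
        split_ifs <;> linarith
      · have h2 : x n = j := by have := hx n; omega
        have := (hslack n hn).1 (by have := hx n; omega)
        rw [currentStream, h2] at this
        split_ifs <;> linarith

theorem eventually_mem_of_recurrentSites {x : ℕ → ℤ} {a b : ℤ} (hab : a ≤ b)
    (hx : ∀ n, x (n + 1) = x n + 1 ∨ x (n + 1) = x n - 1)
    (hR : recurrentSites x = Set.Icc a b) : ∃ N, ∀ n ≥ N, x n ∈ Set.Icc a b := by
  have hout : ∀ z ∉ Set.Icc a b, ∀ᶠ n in atTop, x n ≠ z := by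
    intro z hz
    rw [← hR] at hz
    exact not_frequently.1 hz
  have ha : ∃ᶠ n in atTop, x n = a := by
    have : a ∈ recurrentSites x := by rw [hR]; exact ⟨le_rfl, hab⟩
    exact this
  -- The two sites just outside the interval cannot be jumped over, so avoiding them confines the
  -- path once it is inside.
  obtain ⟨M, hM⟩ := eventually_atTop.1
    ((hout (a - 1) (by simp)).and (hout (b + 1) (by simp)))
  obtain ⟨N, hNM, hN⟩ := frequently_atTop.1 ha M
  refine ⟨N, fun n hn => ?_⟩
  induction n, hn using Nat.le_induction with
  | base => rw [hN]; exact ⟨le_rfl, hab⟩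
  | succ n hn ih =>
    have := hM (n + 1) (by omega)
    have := hx n
    rw [Set.mem_Icc] at ih ⊢
    omega

/-- Chaining the neighbour inequalities outwards from `c` costs at most `t` per edge. -/
theorem le_add_mul_of_unimodal {E : ℕ → ℝ} {c k : ℕ} {t : ℝ} (ht : 0 ≤ t) (hc : c < k)
    (h1 : ∀ i, c ≤ i → i + 1 < k → E i ≤ E (i + 1) + t) (h2 : ∀ i < c, E (i + 1) ≤ E i + t) :
    ∀ i < k, E c ≤ E i + k * t := by
  have up : ∀ i, c ≤ i → i < k → E c ≤ E i + i * t := by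
    intro i hi
    induction i, hi using Nat.le_induction with
    | base => intro _; have : 0 ≤ (c : ℝ) * t := by positivity
              linarith
    | succ i hi ih =>
      intro hik
      have := ih (by omega)
      have := h1 i hi hik
      push_cast
      linarith
  have down : ∀ d ≤ c, E c ≤ E (c - d) + d * t := by
    intro d
    induction d with
    | zero => intro _; simp
    | succ d ih =>
      intro hd
      have h := ih (by omega)
      have h' := h2 (c - (d + 1)) (by omega)
      rw [show c - (d + 1) + 1 = c - d by omega] at h'
      push_cast
      linarith
  intro i hi
  have key : ∀ d : ℕ, d ≤ k → (d : ℝ) * t ≤ k * t := fun d hd =>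
    mul_le_mul_of_nonneg_right (by exact_mod_cast hd) ht
  rcases le_total c i with h | h
  · linarith [up i h hi, key i hi.le]
  · have := down (c - i) (by omega)
    rw [show c - (c - i) = i by omega] at this
    linarith [key (c - i) (by omega)]

/-- The local times of `x` on the edges `a, a + 1, …`. -/
def localProfile (x : ℕ → ℤ) (a : ℤ) (n : ℕ) (i : ℕ) : ℝ := localTime x n (a + i)

theorem stream_eq_sub (α : ℝ) (x : ℕ → ℤ) (a : ℤ) (n i : ℕ) :
    stream α x n (a + 1 + i) = edgePotential α (localProfile x a n) i
      - edgePotential α (localProfile x a n) (i + 1) := by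
  have e0 : a + 1 + (i : ℤ) - 1 = a + i := by ring
  have e1 : a + 1 + (i : ℤ) = a + ((i + 1 : ℕ) : ℤ) := by push_cast; ring
  have e2 : a + 1 + (i : ℤ) + 1 = a + ((i + 1 + 1 : ℕ) : ℤ) := by push_cast; ring
  have e3 : a + 1 + (i : ℤ) + 2 = a + ((i + 1 + 2 : ℕ) : ℤ) := by push_cast; ring
  rw [stream, e0, e2, e3, e1]
  simp only [edgePotential, localProfile]
  ring

theorem localProfile_succ {x : ℕ → ℤ} {n c : ℕ} {a : ℤ}
    (hx : x (n + 1) = x n + 1 ∨ x (n + 1) = x n - 1) (hc : max (x n) (x (n + 1)) = a + 1 + c) :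
    localProfile x a (n + 1) = localProfile x a n + Pi.single (c + 1) 1 := by
  ext i
  rw [Pi.add_apply, Pi.single_apply, localProfile, localProfile, localTime_succ hx, hc]
  congr 2
  simp only [eq_iff_iff]
  omega

/-- Eventually every edge crossed nearly minimises the edge potential. -/
theorem eventually_edgePotential_le {α : ℝ} (hα : 0 ≤ α) {x : ℕ → ℤ} {s : ℕ → ℝ}
    (hs : Monotone s) (hs0 : ∀ n, 0 ≤ s n) {k : ℕ} {a : ℤ}
    (hx : ∀ n, x (n + 1) = x n + 1 ∨ x (n + 1) = x n - 1)
    (hslack : ∀ᶠ n in atTop, (x (n + 1) = x n + 1 → -s n ≤ currentStream α x n) ∧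
      (x (n + 1) = x n - 1 → currentStream α x n ≤ s n))
    (hR : recurrentSites x = Set.Icc a (a + k)) :
    ∀ᶠ n in atTop, ∃ c < k, max (x n) (x (n + 1)) = a + 1 + c ∧
      ∀ i < k, edgePotential α (localProfile x a n) c
        ≤ edgePotential α (localProfile x a n) i + k * (s n + 1) := by
  obtain ⟨N, hN⟩ := eventually_mem_of_recurrentSites (by omega) hx hR
  obtain ⟨M, hM⟩ := eventually_atTop.1 hslack
  have hvisit : ∀ i : Fin k, ∀ᶠ n in atTop, (x n < a + 1 + i → stream α x n (a + 1 + i) ≤ s n + 1) ∧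
      (a + 1 + i < x n → -(s n + 1) ≤ stream α x n (a + 1 + i)) := by
    intro i
    have : a + 1 + ((i : ℕ) : ℤ) ∈ recurrentSites x := by
      rw [hR, Set.mem_Icc]; have := i.2; omega
    obtain ⟨n₀, hn₀, hn₀'⟩ := frequently_atTop.1 this M
    exact eventually_atTop.2 ⟨n₀, stream_bounds hα hs hx (fun n hn => hM n (by omega)) hn₀'⟩
  filter_upwards [eventually_all.2 hvisit, eventually_ge_atTop N, hslack] with n h1 hn hsl
  have hn0 := hN n hn
  have hn1 := hN (n + 1) (by omega)
  rw [Set.mem_Icc] at hn0 hn1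
  have hxn := hx n
  obtain ⟨c, hc⟩ := Int.eq_ofNat_of_zero_le (show 0 ≤ max (x n) (x (n + 1)) - (a + 1) by omega)
  have hck : c < k := by omega
  refine ⟨c, hck, by omega, ?_⟩
  have hs1 : 0 ≤ s n + 1 := by linarith [hs0 n]
  refine le_add_mul_of_unimodal hs1 hck ?_ ?_
  · intro i hi hik
    suffices stream α x n (a + 1 + i) ≤ s n + 1 by rw [stream_eq_sub] at this; linarith
    -- Either the walker is strictly left of the site, or it stands on it and is about to step left;
    -- then `i = c` and the slack bound applies directly.
    rcases lt_or_ge (x n) (a + 1 + i) with h | h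
    · exact (h1 ⟨i, by omega⟩).1 h
    · have e : x n = a + 1 + i := by omega
      have := hsl.2 (by omega)
      rw [currentStream, e] at this
      linarith
  · intro i hi
    suffices -(s n + 1) ≤ stream α x n (a + 1 + i) by rw [stream_eq_sub] at this; linarith
    rcases lt_or_ge (a + 1 + i : ℤ) (x n) with h | h
    · exact (h1 ⟨i, by omega⟩).2 h
    · have e : x n = a + 1 + i := by omega
      have := hsl.1 (by omega)
      rw [currentStream, e] at this
      linarith

/-! ### Energy growth, coercivity and convergence. -/

/-- If every edge crossed nearly minimises the edge potential and the energy is coercive on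
profiles of mass zero, then the local times are asymptotically proportional to the critical
profile `u`. -/
theorem tendsto_localProfile {α lam κ : ℝ} {x : ℕ → ℤ} {s : ℕ → ℝ} (hs : Monotone s)
    (hs0 : ∀ n, 0 ≤ s n) (hslim : Tendsto (fun n : ℕ => s n / n) atTop (𝓝 0)) {k : ℕ} {a : ℤ}
    {u : ℕ → ℝ} (hx : ∀ n, x (n + 1) = x n + 1 ∨ x (n + 1) = x n - 1)
    (hmin : ∀ᶠ n in atTop, ∃ c < k, max (x n) (x (n + 1)) = a + 1 + c ∧
      ∀ i < k, edgePotential α (localProfile x a n) c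
        ≤ edgePotential α (localProfile x a n) i + k * (s n + 1))
    (hu0 : u 0 = 0) (hu1 : u (k + 1) = 0) (hu : ∀ i < k, 0 ≤ u (i + 1))
    (hus : ∑ i ∈ Finset.range k, u (i + 1) = 1) (hlam : ∀ i < k, edgePotential α u i = lam)
    (hκ : 0 < κ) (hcoer : ∀ v : ℕ → ℝ, v 0 = 0 → v (k + 1) = 0 →
      ∑ i ∈ Finset.range k, v (i + 1) = 0 →
        κ * ∑ i ∈ Finset.range k, v (i + 1) ^ 2 ≤ energyForm α k v v) {i : ℕ} (hi : i < k) :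
    Tendsto (fun n : ℕ => 1 / (n : ℝ) * localProfile x a n (i + 1)) atTop (𝓝 (u (i + 1))) := by
  obtain ⟨N, hN⟩ := eventually_atTop.1 hmin
  -- Subtracting the profile at time `N` removes the early crossings, so that `v n` vanishes at the
  -- boundary indices and has mass zero.
  set v : ℕ → ℕ → ℝ := fun n => localProfile x a n - localProfile x a N - ((n : ℝ) - N) • u with hv
  set K : ℝ := ∑ i ∈ Finset.range k, |edgePotential α (localProfile x a N) i| with hK
  -- The term `2 * K` pays for the potential of the subtracted initial profile at the two edges
  -- compared.
  set σ : ℕ → ℝ := fun n => k * (s n + 1) + 2 * K with hσ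
  have hK0 : 0 ≤ K := Finset.sum_nonneg fun i _ => abs_nonneg _
  have hσ0 : ∀ n, 0 ≤ σ n := fun n => by have := hs0 n; simp only [hσ]; positivity
  have hσm : Monotone σ := fun m n h => by
    simp only [hσ]; have := hs h; gcongr
  set C : ℝ := |1 - α - lam| with hC
  have hbound : ∀ n ≥ N, v n 0 = 0 ∧ v n (k + 1) = 0 ∧ ∑ i ∈ Finset.range k, v n (i + 1) = 0 ∧
      energyForm α k (v n) (v n) ≤ ((n : ℝ) - N) * (2 * σ n + C) := by
    intro n hn
    induction n, hn using Nat.le_induction with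
    | base => simp [hv, energyForm]
    | succ n hn ih =>
      obtain ⟨h0, h1, h2, h3⟩ := ih
      obtain ⟨c, hc, hcx, hcm⟩ := hN n hn
      have hstep : v (n + 1) = v n + (Pi.single (c + 1) 1 - u) := by
        simp only [hv, localProfile_succ (hx n) hcx]
        ext j
        simp only [Pi.sub_apply, Pi.add_apply, Pi.smul_apply, smul_eq_mul]
        push_cast
        ring
      have hsum : ∑ i ∈ Finset.range k, (Pi.single (c + 1) 1 : ℕ → ℝ) (i + 1) = 1 := by
        rw [Finset.sum_eq_single_of_mem c (Finset.mem_range.2 hc)]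
        · simp
        · intro j _ hj
          exact Pi.single_eq_of_ne (by omega) _
      have hmin' : ∀ i < k, edgePotential α (v n) c ≤ edgePotential α (v n) i + σ n := by
        intro i hi
        have e : ∀ j, edgePotential α (v n) j = edgePotential α (localProfile x a n) j
            - edgePotential α (localProfile x a N) j - ((n : ℝ) - N) * edgePotential α u j := by
          intro j
          simp only [hv, edgePotential_sub, edgePotential_smul]
        have hle : ∀ j < k, |edgePotential α (localProfile x a N) j| ≤ K := fun j hj =>
          Finset.single_le_sum (f := fun j => |edgePotential α (localProfile x a N) j|)
            (fun i _ => abs_nonneg _) (Finset.mem_range.2 hj)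
        have a1 := abs_le.1 (hle c hc)
        have a2 := abs_le.1 (hle i hi)
        rw [e, e, hlam c hc, hlam i hi]
        simp only [hσ]
        linarith [hcm i hi]
      have hG := energyForm_step_le hu0 hu1 hu hus hlam h0 h1 h2 hc hmin'
      rw [← hstep] at hG
      refine ⟨?_, ?_, ?_, ?_⟩
      · rw [hstep]; simp [h0, hu0]
      · rw [hstep, Pi.add_apply, Pi.sub_apply, h1, hu1, Pi.single_eq_of_ne (by omega)]; simp
      · rw [hstep]
        simp only [Pi.add_apply, Pi.sub_apply, Finset.sum_add_distrib, Finset.sum_sub_distrib, h2,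
          hsum, hus]
        simp
      · have hnN : (0 : ℝ) ≤ (n : ℝ) - N := sub_nonneg.2 (by exact_mod_cast hn)
        have hm := hσm n.le_succ
        have := le_abs_self (1 - α - lam)
        calc energyForm α k (v (n + 1)) (v (n + 1))
            ≤ ((n : ℝ) - N) * (2 * σ n + C) + (2 * σ n + C) := by linarith
          _ = ((n : ℝ) - N + 1) * (2 * σ n + C) := by ring
          _ ≤ ((n : ℝ) - N + 1) * (2 * σ (n + 1) + C) := by gcongr
          _ = (((n + 1 : ℕ) : ℝ) - N) * (2 * σ (n + 1) + C) := by push_cast; ring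
  have hinv : Tendsto (fun n : ℕ => (n : ℝ)⁻¹) atTop (𝓝 0) := tendsto_inv_atTop_nhds_zero_nat
  have hlim : Tendsto (fun n : ℕ => (2 * σ n + C) / n / κ) atTop (𝓝 0) := by
    have e : (fun n : ℕ => (2 * σ n + C) / n / κ)
        = fun n : ℕ => (2 * k * (s n / n) + (2 * k + 4 * K + C) * (n : ℝ)⁻¹) / κ := by
      ext n; simp only [hσ]; ring
    rw [e]
    have := ((hslim.const_mul (2 * k : ℝ)).add (hinv.const_mul (2 * k + 4 * K + C))).div_const κ
    simpa using this
  -- Coercivity gives `κ v² ≤ n (2 σ + C)`; dividing by `κ n²` and taking the square root leaves a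
  -- bound tending to zero.
  have hvlim : Tendsto (fun n : ℕ => v n (i + 1) / n) atTop (𝓝 0) := by
    have hsqrt := (Real.continuous_sqrt.tendsto 0).comp hlim
    rw [Real.sqrt_zero] at hsqrt
    refine squeeze_zero_norm' ?_ hsqrt
    filter_upwards [eventually_ge_atTop N, eventually_gt_atTop 0] with n hn hn0
    have hnpos : (0 : ℝ) < n := by exact_mod_cast hn0
    obtain ⟨h0, h1, h2, h3⟩ := hbound n hn
    have h4 : v n (i + 1) ^ 2 ≤ ∑ i ∈ Finset.range k, v n (i + 1) ^ 2 :=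
      Finset.single_le_sum (f := fun i => v n (i + 1) ^ 2) (fun i _ => sq_nonneg _)
        (Finset.mem_range.2 hi)
    have h5 := hcoer _ h0 h1 h2
    have hC0 : 0 ≤ 2 * σ n + C := by have := hσ0 n; have := abs_nonneg (1 - α - lam); linarith
    have h6 : κ * v n (i + 1) ^ 2 ≤ n * (2 * σ n + C) := by
      have : ((n : ℝ) - N) * (2 * σ n + C) ≤ n * (2 * σ n + C) :=
        mul_le_mul_of_nonneg_right (by simp) hC0
      have := mul_le_mul_of_nonneg_left h4 hκ.le
      linarith
    rw [Real.norm_eq_abs]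
    apply Real.abs_le_sqrt
    change _ ≤ (2 * σ n + C) / n / κ
    rw [div_pow, div_div, div_le_div_iff₀ (by positivity) (by positivity)]
    calc v n (i + 1) ^ 2 * (n * κ) = n * (κ * v n (i + 1) ^ 2) := by ring
      _ ≤ n * (n * (2 * σ n + C)) := by gcongr
      _ = (2 * σ n + C) * n ^ 2 := by ring
  have hfin : Tendsto (fun n : ℕ => v n (i + 1) / n
      + (localProfile x a N (i + 1) - N * u (i + 1)) * (n : ℝ)⁻¹ + u (i + 1)) atTop
      (𝓝 (u (i + 1))) := by
    have := (hvlim.add (hinv.const_mul (localProfile x a N (i + 1) - N * u (i + 1)))).add_const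
      (u (i + 1))
    simpa using this
  refine hfin.congr' ?_
  filter_upwards [eventually_gt_atTop 0] with n hn0
  have hnpos : (n : ℝ) ≠ 0 := by exact_mod_cast hn0.ne'
  simp only [hv, Pi.sub_apply, Pi.smul_apply, smul_eq_mul]
  field_simp
  ring

theorem tendsto_log_succ_div (β : ℝ) :
    Tendsto (fun n : ℕ => Real.log (n + 1) / β / n) atTop (𝓝 0) := by
  have h1 : Tendsto (fun n : ℕ => Real.log ((n + 1 : ℕ) : ℝ) / ((n + 1 : ℕ) : ℝ)) atTop (𝓝 0) :=
    (Real.isLittleO_log_id_atTop.tendsto_div_nhds_zero.comp tendsto_natCast_atTop_atTop).comp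
      (tendsto_add_atTop_nat 1)
  have h2 : Tendsto (fun n : ℕ => 1 + (n : ℝ)⁻¹) atTop (𝓝 (1 + 0)) :=
    tendsto_inv_atTop_nhds_zero_nat.const_add 1
  have h3 := (h1.mul h2).div_const β
  rw [zero_mul, zero_div] at h3
  refine h3.congr' ?_
  filter_upwards [eventually_gt_atTop 0] with n hn
  have hn' : (n : ℝ) ≠ 0 := by exact_mod_cast hn.ne'
  have hn1 : (n : ℝ) + 1 ≠ 0 := by positivity
  push_cast
  field_simp

end StuckWalk

/-! ### The limit theorem. -/

theorem mainTheorem4 (L : ℕ) (hL : 1 ≤ L) (α β : ℝ) (hβ : 0 < β)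
    (hα_lower : StuckWalk.criticalValue (L + 1) < (α : EReal))
    (hα_upper : (α : EReal) < StuckWalk.criticalValue L)
    {Ω : Type*} [MeasurableSpace Ω] (P : Measure Ω) [IsProbabilityMeasure P]
    (X : ℕ → Ω → ℤ) (hX : StuckWalk.IsWalk P α β X) :
    (∑ j ∈ Finset.Icc 1 (L + 1), StuckWalk.profile α L j = 1) ∧
    ∀ᵐ ω ∂P, ∀ x : ℤ,
      StuckWalk.recurrentSites (fun n => X n ω) = Set.Icc x (x + (L : ℤ) + 1) →
      Tendsto
        (fun (n : ℕ) (i : Fin (L + 1)) =>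
          (1 / (n : ℝ)) *
            (StuckWalk.localTime (fun m => X m ω) n (x + ((i : ℕ) : ℤ) + 1) : ℝ))
        atTop (𝓝 (fun i : Fin (L + 1) => StuckWalk.profile α L ((i : ℕ) + 1))) := by
  open StuckWalk in
  obtain ⟨hα, hcos⟩ := parameter_bounds hL hα_lower hα_upper
  have hfreq := freq_mul_lt hα hcos
  refine ⟨sum_profile hα hfreq, ?_⟩
  filter_upwards [hX.ae_step, hX.ae_eventually_stream hβ] with ω hstep hslack x hR
  rw [tendsto_pi_nhds]
  intro i
  have hs : Monotone fun n : ℕ => Real.log (n + 1) / β := fun m n h =>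
    div_le_div_of_nonneg_right (Real.log_le_log (by positivity) (by gcongr)) hβ.le
  have hs0 : ∀ n : ℕ, 0 ≤ Real.log (n + 1) / β := fun n =>
    div_nonneg (Real.log_nonneg (by simp)) hβ.le
  have hR' : recurrentSites (fun n => X n ω) = Set.Icc x (x + ((L + 1 : ℕ) : ℤ)) := by
    rw [hR]; push_cast; rw [add_assoc]
  have hpos := sum_weight_pos hα hfreq
  -- There are `k = L + 1` edges, so the closed cycle has length `L + 2`, and the bound from the
  -- upper critical value is the coercivity condition.
  have hκ : 0 < 1 - α - 2 * α * Real.cos (2 * Real.pi / (L + 1 + 1 : ℕ)) := by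
    rw [lt_div_iff₀ (by linarith)] at hcos
    rw [show ((L + 1 + 1 : ℕ) : ℝ) = L + 2 by push_cast; ring]
    linarith
  have key := tendsto_localProfile hs hs0 (tendsto_log_succ_div β) hstep
    (eventually_edgePotential_le (by linarith) hs hs0 hstep hslack hR')
    (u := profile α L) (by simp [profile, weight_zero]) (by simp [profile, weight_add_two])
    (fun j hj => (div_pos (weight_pos hα hfreq (by omega) (by omega)) hpos).le)
    (sum_range_profile hα hfreq) (fun j _ => edgePotential_profile hα L j) hκ
    (fun v h0 h1 h2 => le_energyForm_self (by linarith) h0 h1 h2) i.2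
  refine key.congr fun n => ?_
  rw [localProfile]
  push_cast
  rw [add_assoc]
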